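/- Theorem 2.11. Let $0<s<1$ and let $N\ge 1$ be an integer with $N>2s$. Let $\rho,c\in C(\mathbb R^N)$ be such that - (H0) $\rho(x)>0$ for all $x\in\mathbb R^N$, and there are $K>0$ and $\alpha<s$ with $\rho(x)\ge K(1+|x|^2)^{-\alpha}$ for all $x\in\mathbb R^N$; - (H1) $c(x)\ge 0$ for all $x\in\mathbb R^N$; - for some $c_0>0$, $c(x)\ge c_0$ for all $x\in\mathbb R^N$. Let $F\in C_c^\infty(\mathbb R^N)$, $F\ge 0$, $F\not\equiv 0$, and let $\phi=I_{2s}*F$ be its Riesz potential, where $I_{2s}(x)=k_{N,s}|x|^{-(N-2s)}$ and $k_{N,s}=\Gamma(\tfrac{N-2s}{2})\big/\big(4^s\pi^{N/2}\Gamma(s)\big)$. Let $u$ be a solution of $$(-\Delta)^s u+\rho c u=0\quad\text{in }\mathbb R^N ,$$ that is: $u:\mathbb R^N\to\mathbb R$ is measurable with $\int_{\mathbb R^N}\frac{|u(x)|}{1+|x|^{N+2s}}\,dx<\infty$; for some $\gamma>0$, $u\in C^{2s+\gamma}_{loc}(\mathbb R^N)$ if $s<\frac12$, or $u\in C^{1,2s+\gamma-1}_{loc}(\mathbb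 R^N)$ if $s\ge\frac12$; and, for every $x\in\mathbb R^N$, $$C_{N,s}\,\mathrm{P.V.}\!\int_{\mathbb R^N}\frac{u(x)-u(y)}{|x-y|^{N+2s}}\,dy+\rho(x)c(x)u(x)=0,\qquad C_{N,s}=\frac{2^{2s-1}\,2s\,\Gamma(\frac{N+2s}{2})}{\pi^{N/2}\,\Gamma(1-s)} .$$ If $\int_{\mathbb R^N}|u|^p\,c\,\rho\,\phi\,dx<\infty$ for some real $p\ge 1$, then $u\equiv 0$ in $\mathbb R^N$. -/

import Mathlib

open MeasureTheory Set Filter Topology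
open scoped ContDiff

noncomputable section

namespace FracElliptic

/-- The normalising constant `C_{N,s} = 2^{2s-1} 2s Γ((N+2s)/2) / (π^{N/2} Γ(1-s))`
of the fractional Laplacian. -/
def fracConst (N : ℕ) (s : ℝ) : ℝ :=
  (2 : ℝ) ^ (2 * s - 1) * (2 * s) * Real.Gamma (((N : ℝ) + 2 * s) / 2) /
    (Real.pi ^ ((N : ℝ) / 2) * Real.Gamma (1 - s))

/-- `(-Δ)^s u (x) = L` in the pointwise sense: the principal value
`C_{N,s} lim_{ε → 0+} ∫_{|x-y| > ε} (u(x) - u(y)) / |x-y|^{N+2s} dy` exists and equals `L`. -/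
def HasFracLaplacianAt {N : ℕ} (s : ℝ) (u : EuclideanSpace ℝ (Fin N) → ℝ) (L : ℝ)
    (x : EuclideanSpace ℝ (Fin N)) : Prop :=
  Tendsto
    (fun ε : ℝ => fracConst N s *
      ∫ y in {y | ε < ‖x - y‖}, (u x - u y) / ‖x - y‖ ^ ((N : ℝ) + 2 * s))
    (𝓝[>] 0) (𝓝 L)

/-- The space `𝓛^s(ℝ^N)`: measurable functions with `∫ |u(x)| / (1 + |x|^{N+2s}) dx < ∞`. -/
def MemLs {N : ℕ} (s : ℝ) (u : EuclideanSpace ℝ (Fin N) → ℝ) : Prop :=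
  Measurable u ∧ Integrable (fun x => |u x| / (1 + ‖x‖ ^ ((N : ℝ) + 2 * s)))

/-- `f` is Hölder continuous with exponent `r` on every compact set (used with `0 < r ≤ 1`). -/
def LocHolder {N : ℕ} {F : Type*} [PseudoEMetricSpace F] (r : ℝ)
    (f : EuclideanSpace ℝ (Fin N) → F) : Prop :=
  ∀ K : Set (EuclideanSpace ℝ (Fin N)), IsCompact K →
    ∃ C : NNReal, HolderOnWith C r.toNNReal f K

/-- For some `γ > 0`: `u ∈ C^{2s+γ}_loc` if `s < 1/2`, and `u ∈ C^{1,2s+γ-1}_loc` if `s ≥ 1/2`.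
The bounds `2s+γ ≤ 1`, resp. `2s+γ-1 ≤ 1`, keep the Hölder exponent in `(0,1]`; they lose nothing,
as these local classes shrink when `γ` grows. -/
def FracRegular {N : ℕ} (s : ℝ) (u : EuclideanSpace ℝ (Fin N) → ℝ) : Prop :=
  ∃ γ : ℝ, 0 < γ ∧
    ((s < 1 / 2 → 2 * s + γ ≤ 1 ∧ LocHolder (2 * s + γ) u) ∧
      (1 / 2 ≤ s → 2 * s + γ - 1 ≤ 1 ∧ ContDiff ℝ 1 u ∧
        LocHolder (2 * s + γ - 1) (fderiv ℝ u)))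

/-- `u` is a solution of `(-Δ)^s u + ρ c u = 0` in `ℝ^N`. -/
structure IsSolution {N : ℕ} (s : ℝ) (ρ c u : EuclideanSpace ℝ (Fin N) → ℝ) : Prop where
  memLs : MemLs s u
  regular : FracRegular s u
  equation : ∀ x, HasFracLaplacianAt s u (-(ρ x * c x * u x)) x

/-- The weighted space `L^p_w(ℝ^N)`: measurable `u` with `∫ |u|^p w dx < ∞`, for a weight
`w ≥ 0`. -/
def MemWeightedLp {N : ℕ} (p : ℝ) (w u : EuclideanSpace ℝ (Fin N) → ℝ) : Prop :=
  Measurable u ∧ ∫⁻ x, ENNReal.ofReal (|u x| ^ p * w x) < ⊤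

/-- The Riesz kernel `I_{2s}(x) = k_{N,s} / |x|^{N-2s}` with
`k_{N,s} = Γ((N-2s)/2) / (4^s π^{N/2} Γ(s))`, for `2s < N`. -/
def rieszKernel (N : ℕ) (s : ℝ) (x : EuclideanSpace ℝ (Fin N)) : ℝ :=
  Real.Gamma (((N : ℝ) - 2 * s) / 2) /
      ((4 : ℝ) ^ s * Real.pi ^ ((N : ℝ) / 2) * Real.Gamma s) /
    ‖x‖ ^ ((N : ℝ) - 2 * s)

/-- The Riesz potential `I_{2s} * F`. -/
def rieszPotential {N : ℕ} (s : ℝ) (F : EuclideanSpace ℝ (Fin N) → ℝ)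
    (x : EuclideanSpace ℝ (Fin N)) : ℝ :=
  ∫ y, rieszKernel N s (x - y) * F y

end FracElliptic

end

/-! The equation gives a localized estimate, and dyadic summation turns it into a self-improving
inequality that only the zero function satisfies.

Kato's inequality `|a| - |b| ≤ sign a * (a - b)`, integrated against the symmetric truncated kernel
and a bump rescaled to radius `r`, moves the operator onto the bump
(`integral_abs_mul_truncLap_le`). On the bump the operator is `O(r^(-2s) (1 + |x|/r)^(-(N+2s)))`,
uniformly in the truncation. On `u` the Hölder regularity gives bounds uniform in `ε` on compact
sets, so `ε → 0` is allowed and the equation enters: the integral of `ρ c |u|` over the ball of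
radius `r` is at most `C r^(-2s) ∫ (1 + |x|/r)^(-(N+2s)) |u|`
(`IsSolution.exists_setIntegral_closedBall_le`).

Since `ρ c` is bounded below by a multiple of `(1 + |x|)^(-2a)` with `0 ≤ a < s`, the estimates at
radii `R 2^k`, weighted by `2^(-k(N-2a))`, add up to `X ≤ C' R^(-2(s-a)) X`, where `X = ∫ (1 +
|x|/R)^(-(N-2a)) (1 + |x|)^(-2a) |u|` (`lintegral_dyadic_le`). For large `R` this forces `X = 0`,
provided `X` is finite (`ae_eq_zero_of_localized_le`).

Finiteness is the role of the weighted `L^p` hypothesis: the Riesz potential is at least a multiple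
of `(1 + |x|)^(-(N-2s))`, so the weight exceeds a multiple of `(1 + |x|)^(-N + 2(s-a))`, and the
gain `2(s-a) > 0` yields `∫ (1 + |x|)^(-N) |u| < ∞` for every `p ≥ 1`
(`MemWeightedLp.tailIntegrable`). -/

namespace FracElliptic

/-! ### Truncated kernels and integrability of tails -/

variable {N : ℕ} {q ε : ℝ}

/-- The kernel `|z|^{-q}` cut off in the ball of radius `ε`. -/
noncomputable def truncKernel {N : ℕ} (q ε : ℝ) (z : EuclideanSpace ℝ (Fin N)) : ℝ :=
  if ε < ‖z‖ then ‖z‖ ^ (-q) else 0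

/-- The truncated nonlocal operator `∫_{|x-y|>ε} (u(x) - u(y)) / |x-y|^q dy`. -/
noncomputable def truncLap {N : ℕ} (q ε : ℝ) (u : EuclideanSpace ℝ (Fin N) → ℝ)
    (x : EuclideanSpace ℝ (Fin N)) : ℝ :=
  ∫ y, truncKernel q ε (x - y) * (u x - u y)

/-- Measurable functions with `∫ |u(x)| (1 + |x|)^{-q} dx < ∞`. -/
structure TailIntegrable {N : ℕ} (q : ℝ) (u : EuclideanSpace ℝ (Fin N) → ℝ) : Prop where
  measurable : Measurable u
  integrable : Integrable (fun x => (1 + ‖x‖) ^ (-q) * |u x|)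

lemma truncKernel_nonneg (z : EuclideanSpace ℝ (Fin N)) : 0 ≤ truncKernel q ε z := by
  unfold truncKernel
  split_ifs <;> positivity

lemma truncKernel_neg (z : EuclideanSpace ℝ (Fin N)) :
    truncKernel q ε (-z) = truncKernel q ε z := by
  simp [truncKernel]

lemma truncKernel_sub_comm (x y : EuclideanSpace ℝ (Fin N)) :
    truncKernel q ε (x - y) = truncKernel q ε (y - x) := by
  rw [← truncKernel_neg, neg_sub]

@[fun_prop]
lemma measurable_truncKernel :
    Measurable (truncKernel q ε : EuclideanSpace ℝ (Fin N) → ℝ) := by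
  unfold truncKernel
  exact Measurable.ite (measurableSet_lt measurable_const measurable_norm) (by fun_prop) (by fun_prop)

/-- A Peetre-type inequality, from `1 + |y| ≤ (1 + |x|)(1 + |x - y|)`. It separates the variables in
the kernel, which makes the product-space integrability below a matter of two single integrals. -/
lemma one_add_norm_sub_rpow_neg_le (hq : 0 ≤ q) (x y : EuclideanSpace ℝ (Fin N)) :
    (1 + ‖x - y‖) ^ (-q) ≤ (1 + ‖x‖) ^ q * (1 + ‖y‖) ^ (-q) := by
  have h1 : 1 + ‖y‖ ≤ (1 + ‖x‖) * (1 + ‖x - y‖) := by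
    have := norm_sub_norm_le y x
    rw [norm_sub_rev] at this
    nlinarith [norm_nonneg x, norm_nonneg (x - y), mul_nonneg (norm_nonneg x) (norm_nonneg (x - y))]
  rw [Real.rpow_neg (by positivity), Real.rpow_neg (by positivity), ← div_eq_mul_inv,
    inv_le_comm₀ (by positivity) (by positivity), inv_div, div_le_iff₀ (by positivity), mul_comm,
    ← Real.mul_rpow (by positivity) (by positivity)]
  exact Real.rpow_le_rpow (by positivity) h1 hq

lemma truncKernel_le (hq : 0 ≤ q) (hε : 0 < ε) (z : EuclideanSpace ℝ (Fin N)) :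
    truncKernel q ε z ≤ (1 + 1 / ε) ^ q * (1 + ‖z‖) ^ (-q) := by
  unfold truncKernel
  split_ifs with h
  · have hz : 0 < ‖z‖ := hε.trans h
    have h1 : 1 + ‖z‖ ≤ (1 + 1 / ε) * ‖z‖ := by
      have : 1 ≤ 1 / ε * ‖z‖ := by
        rw [one_div, ← div_eq_inv_mul, one_le_div hε]; exact h.le
      linarith
    rw [Real.rpow_neg (by positivity), Real.rpow_neg (by positivity), ← div_eq_mul_inv,
      inv_le_comm₀ (by positivity) (by positivity), inv_div, div_le_iff₀ (by positivity), mul_comm,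
      ← Real.mul_rpow (by positivity) (by positivity)]
    exact Real.rpow_le_rpow (by positivity) h1 hq
  · positivity

lemma truncKernel_sub_le (hq : 0 ≤ q) (hε : 0 < ε) (x y : EuclideanSpace ℝ (Fin N)) :
    truncKernel q ε (x - y) ≤ (1 + 1 / ε) ^ q * (1 + ‖x‖) ^ q * (1 + ‖y‖) ^ (-q) := by
  refine (truncKernel_le hq hε _).trans ?_
  rw [mul_assoc]
  exact mul_le_mul_of_nonneg_left (one_add_norm_sub_rpow_neg_le hq x y) (by positivity)

lemma integrable_truncKernel (hq : (N : ℝ) < q) (hε : 0 < ε) :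
    Integrable (truncKernel q ε : EuclideanSpace ℝ (Fin N) → ℝ) := by
  have hq0 : 0 ≤ q := (Nat.cast_nonneg N).trans hq.le
  have h : Integrable (fun z : EuclideanSpace ℝ (Fin N) => (1 + ‖z‖) ^ (-q)) :=
    integrable_one_add_norm (by simpa using hq)
  refine (h.const_mul ((1 + 1 / ε) ^ q)).mono' measurable_truncKernel.aestronglyMeasurable ?_
  filter_upwards with z
  rw [Real.norm_of_nonneg (truncKernel_nonneg z)]
  exact truncKernel_le hq0 hε z

lemma TailIntegrable.abs {u : EuclideanSpace ℝ (Fin N) → ℝ} (hu : TailIntegrable q u) :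
    TailIntegrable q (fun x => |u x|) :=
  ⟨hu.measurable.norm, by simpa using hu.integrable⟩

lemma TailIntegrable.integrable_truncKernel_mul {u : EuclideanSpace ℝ (Fin N) → ℝ}
    (hu : TailIntegrable q u) (hq : 0 ≤ q) (hε : 0 < ε) (x : EuclideanSpace ℝ (Fin N)) :
    Integrable (fun y => truncKernel q ε (x - y) * u y) := by
  have hm := hu.measurable
  refine (hu.integrable.const_mul ((1 + 1 / ε) ^ q * (1 + ‖x‖) ^ q)).mono'
    (by fun_prop) ?_
  filter_upwards with y
  rw [norm_mul, Real.norm_of_nonneg (truncKernel_nonneg _), Real.norm_eq_abs, ← mul_assoc]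
  exact mul_le_mul_of_nonneg_right (truncKernel_sub_le hq hε x y) (abs_nonneg _)

lemma TailIntegrable.integrable_truncLap_integrand {u : EuclideanSpace ℝ (Fin N) → ℝ}
    (hu : TailIntegrable q u) (hq : (N : ℝ) < q) (hε : 0 < ε) (x : EuclideanSpace ℝ (Fin N)) :
    Integrable (fun y => truncKernel q ε (x - y) * (u x - u y)) := by
  simp_rw [mul_sub]
  exact (((integrable_truncKernel hq hε).comp_sub_left x).mul_const _).sub
    (hu.integrable_truncKernel_mul ((Nat.cast_nonneg N).trans hq.le) hε x)

/-! ### Bounds for the truncated operator, uniform in the truncation -/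

lemma integrable_norm_rpow_of_norm_le_one (hN : 1 ≤ N) {β : ℝ} (hβ : -(N : ℝ) < β) :
    Integrable (fun z : EuclideanSpace ℝ (Fin N) => if ‖z‖ ≤ 1 then ‖z‖ ^ β else 0) := by
  have h : IntegrableOn (fun z : EuclideanSpace ℝ (Fin N) => ‖z‖ ^ β) (Metric.ball 0 2) := by
    refine integrableOn_ball_of_norm_le_rpow (C := 1) (α := -β) (by simpa using hN)
      (by simp; linarith) ?_
      (measurable_norm.pow_const β).aestronglyMeasurable
    filter_upwards with z
    rw [Real.norm_of_nonneg (by positivity)]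
    simp
  have h' := h.mono_set (Metric.closedBall_subset_ball (x := (0 : EuclideanSpace ℝ (Fin N)))
    (show (1 : ℝ) < 2 by norm_num))
  refine ((integrable_indicator_iff measurableSet_closedBall).2 h').congr ?_
  filter_upwards with z
  simp [indicator]

lemma truncLap_eq_integral_add (u : EuclideanSpace ℝ (Fin N) → ℝ)
    (x : EuclideanSpace ℝ (Fin N)) :
    truncLap q ε u x = ∫ z, truncKernel q ε z * (u x - u (x + z)) := by
  unfold truncLap
  rw [← integral_add_left_eq_self _ x]
  refine integral_congr_ae ?_
  filter_upwards with z
  rw [sub_add_cancel_left, truncKernel_neg]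

/-- A first-order Taylor expansion on the ball of radius `r`, with a remainder of order `β`. -/
def TaylorBound (r β C : ℝ) (u : EuclideanSpace ℝ (Fin N) → ℝ) : Prop :=
  ∀ x, ‖x‖ ≤ r → ∃ A : EuclideanSpace ℝ (Fin N) →L[ℝ] ℝ, ∀ z, ‖z‖ ≤ 1 →
    |u (x + z) - u x - A z| ≤ C * ‖z‖ ^ β

/-- The difference of the two kernels is `|z|^(-q)` on the shell `ε < |z| ≤ 1` and zero elsewhere;
it isolates the singular part from the tail. -/
lemma truncKernel_sub_one_nonneg (hε1 : ε ≤ 1) (z : EuclideanSpace ℝ (Fin N)) :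
    0 ≤ truncKernel q ε z - truncKernel q 1 z := by
  unfold truncKernel
  split_ifs with h1 h2 h2
  · simp
  · simp; positivity
  · linarith
  · simp

lemma truncKernel_sub_one_mul_rpow_le (β : ℝ) (hε0 : 0 < ε) (z : EuclideanSpace ℝ (Fin N)) :
    (truncKernel q ε z - truncKernel q 1 z) * ‖z‖ ^ β ≤
      if ‖z‖ ≤ 1 then ‖z‖ ^ (β - q) else 0 := by
  unfold truncKernel
  split_ifs with h1 h2 h3 h3 h2 h3
  · linarith
  · simp
  · rw [sub_zero, ← Real.rpow_add (hε0.trans h1)]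
    exact le_of_eq (by ring_nf)
  · linarith
  · linarith
  · rw [zero_sub, neg_mul]
    exact neg_nonpos.2 (by positivity)
  · rw [sub_zero, zero_mul]; positivity
  · linarith

lemma truncKernel_sub_one_eq_zero {z : EuclideanSpace ℝ (Fin N)} (hε1 : ε ≤ 1) (hz : 1 < ‖z‖) :
    truncKernel q ε z - truncKernel q 1 z = 0 := by
  simp [truncKernel, hz, hε1.trans_lt hz]

/-- The linear Taylor term is odd and the kernel even, so it integrates to zero: this is the
principal value cancellation. The remainder is dominated by `|z|^(β-q)`, integrable on the unit ball
because `β > q - N`, with no dependence on `ε`. -/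
lemma abs_truncLap_sub_truncLap_one_le {u : EuclideanSpace ℝ (Fin N) → ℝ} {r β C : ℝ}
    (hu : TailIntegrable q u) (hN : 1 ≤ N) (hq : (N : ℝ) < q) (hβ : q - N < β)
    (hT : TaylorBound r β C u) (hC : 0 ≤ C) (hε0 : 0 < ε) (hε1 : ε ≤ 1)
    {x : EuclideanSpace ℝ (Fin N)} (hx : ‖x‖ ≤ r) :
    |truncLap q ε u x - truncLap q 1 u x| ≤
      C * ∫ z : EuclideanSpace ℝ (Fin N), if ‖z‖ ≤ 1 then ‖z‖ ^ (β - q) else 0 := by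
  obtain ⟨A, hA⟩ := hT x hx
  have hshift : ∀ ε' : ℝ, 0 < ε' →
      Integrable (fun z => truncKernel q ε' z * (u x - u (x + z))) := by
    intro ε' hε'
    refine ((hu.integrable_truncLap_integrand hq hε' x).comp_add_left x).congr ?_
    filter_upwards with z
    rw [sub_add_cancel_left, truncKernel_neg]
  have hk : Integrable (fun z : EuclideanSpace ℝ (Fin N) =>
      truncKernel q ε z - truncKernel q 1 z) :=
    (integrable_truncKernel hq hε0).sub (integrable_truncKernel hq one_pos)
  have hkA : Integrable (fun z => (truncKernel q ε z - truncKernel q 1 z) * A z) := by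
    refine (hk.mul_const ‖A‖).mono' (by fun_prop) ?_
    filter_upwards with z
    rw [norm_mul, Real.norm_of_nonneg (truncKernel_sub_one_nonneg hε1 z)]
    by_cases hz : 1 < ‖z‖
    · simp [truncKernel_sub_one_eq_zero hε1 hz]
    · refine mul_le_mul_of_nonneg_left ?_ (truncKernel_sub_one_nonneg hε1 z)
      exact (A.le_opNorm z).trans (mul_le_of_le_one_right (norm_nonneg _) (not_lt.1 hz))
  have hodd : ∫ z, (truncKernel q ε z - truncKernel q 1 z) * A z = 0 := by
    have h := integral_neg_eq_self
      (fun z => (truncKernel q ε z - truncKernel q 1 z) * A z) (volume)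
    simp only [truncKernel_neg, map_neg, mul_neg, integral_neg] at h
    linarith
  have hdiff : truncLap q ε u x - truncLap q 1 u x =
      ∫ z, (truncKernel q ε z - truncKernel q 1 z) * (u x - u (x + z) + A z) := by
    simp_rw [mul_add]
    rw [integral_add _ hkA, hodd, add_zero, truncLap_eq_integral_add, truncLap_eq_integral_add,
      ← integral_sub (hshift ε hε0) (hshift 1 one_pos)]
    · simp_rw [sub_mul]
    · simp_rw [sub_mul]
      exact (hshift ε hε0).sub (hshift 1 one_pos)
  rw [hdiff, ← integral_const_mul, ← Real.norm_eq_abs]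
  refine norm_integral_le_of_norm_le
    ((integrable_norm_rpow_of_norm_le_one hN (by linarith)).const_mul C) ?_
  filter_upwards with z
  rw [norm_mul, Real.norm_of_nonneg (truncKernel_sub_one_nonneg hε1 z)]
  by_cases hz : 1 < ‖z‖
  · simp [truncKernel_sub_one_eq_zero hε1 hz, hz.not_ge]
  · refine le_trans (mul_le_mul_of_nonneg_left (c := C * ‖z‖ ^ β) ?_
      (truncKernel_sub_one_nonneg hε1 z)) ?_
    · rw [Real.norm_eq_abs, show u x - u (x + z) + A z = -(u (x + z) - u x - A z) by ring, abs_neg]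
      exact hA z (not_lt.1 hz)
    · rw [mul_left_comm]
      exact mul_le_mul_of_nonneg_left (truncKernel_sub_one_mul_rpow_le β hε0 z) hC

lemma exists_abs_truncLap_one_le {u : EuclideanSpace ℝ (Fin N) → ℝ} {r M : ℝ}
    (hu : TailIntegrable q u) (hq : (N : ℝ) < q) (hM : ∀ x, ‖x‖ ≤ r → |u x| ≤ M) :
    ∃ C, ∀ x, ‖x‖ ≤ r → |truncLap q 1 u x| ≤ C := by
  have hq0 : 0 ≤ q := (Nat.cast_nonneg N).trans hq.le
  refine ⟨(∫ z : EuclideanSpace ℝ (Fin N), truncKernel q 1 z) * M +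
    (1 + 1 / 1) ^ q * (1 + r) ^ q * ∫ y, (1 + ‖y‖) ^ (-q) * |u y|, fun x hx => ?_⟩
  have hK := (integrable_truncKernel (N := N) (q := q) hq one_pos).comp_sub_left x
  have h1 : Integrable (fun y => truncKernel q 1 (x - y) * M) := hK.mul_const M
  have h2 : Integrable (fun y => (1 + 1 / 1) ^ q * (1 + r) ^ q * ((1 + ‖y‖) ^ (-q) * |u y|)) :=
    hu.integrable.const_mul _
  rw [← integral_sub_left_eq_self _ volume x, ← integral_mul_const, ← integral_const_mul,
    ← integral_add h1 h2]
  rw [truncLap, ← Real.norm_eq_abs]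
  refine norm_integral_le_of_norm_le (h1.add h2) ?_
  filter_upwards with y
  rw [norm_mul, Real.norm_of_nonneg (truncKernel_nonneg _), Real.norm_eq_abs]
  have h3 : |u x - u y| ≤ M + |u y| := (abs_sub _ _).trans (by linarith [hM x hx])
  refine (mul_le_mul_of_nonneg_left h3 (truncKernel_nonneg _)).trans ?_
  rw [mul_add]
  refine add_le_add_right ?_ _
  rw [← mul_assoc]
  refine mul_le_mul_of_nonneg_right ((truncKernel_sub_le hq0 one_pos x y).trans ?_) (abs_nonneg _)
  gcongr

lemma exists_abs_truncLap_le {u : EuclideanSpace ℝ (Fin N) → ℝ} {r β C M : ℝ}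
    (hu : TailIntegrable q u) (hN : 1 ≤ N) (hq : (N : ℝ) < q) (hβ : q - N < β)
    (hT : TaylorBound r β C u) (hC : 0 ≤ C) (hM : ∀ x, ‖x‖ ≤ r → |u x| ≤ M) :
    ∃ B, ∀ x, ‖x‖ ≤ r → ∀ ε, 0 < ε → ε ≤ 1 → |truncLap q ε u x| ≤ B := by
  obtain ⟨B, hB⟩ := exists_abs_truncLap_one_le hu hq hM
  refine ⟨C * (∫ z : EuclideanSpace ℝ (Fin N), if ‖z‖ ≤ 1 then ‖z‖ ^ (β - q) else 0) + B,
    fun x hx ε hε0 hε1 => ?_⟩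
  have h := abs_truncLap_sub_truncLap_one_le hu hN hq hβ hT hC hε0 hε1 hx
  calc |truncLap q ε u x| ≤ |truncLap q ε u x - truncLap q 1 u x| + |truncLap q 1 u x| := by
        simpa using abs_add_le (truncLap q ε u x - truncLap q 1 u x) (truncLap q 1 u x)
    _ ≤ _ := add_le_add h (hB x hx)

/-! ### Kato's inequality -/

lemma measurable_truncLap {u : EuclideanSpace ℝ (Fin N) → ℝ} (hu : Measurable u) :
    Measurable (truncLap q ε u) := by
  refine StronglyMeasurable.measurable ?_
  unfold truncLap
  refine StronglyMeasurable.integral_prod_right' (f := fun z : EuclideanSpace ℝ (Fin N) ×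
    EuclideanSpace ℝ (Fin N) => truncKernel q ε (z.1 - z.2) * (u z.1 - u z.2)) ?_
  exact Measurable.stronglyMeasurable (by fun_prop)

lemma measurable_sign_comp {u : EuclideanSpace ℝ (Fin N) → ℝ} (hu : Measurable u) :
    Measurable fun x => ((SignType.sign (u x) : SignType) : ℝ) := by
  have h : (fun x => ((SignType.sign (u x) : SignType) : ℝ)) =
      (fun t : ℝ => if 0 < t then (1 : ℝ) else if t < 0 then -1 else 0) ∘ u := by
    ext x
    simp only [sign_apply, Function.comp]
    split_ifs <;> simp
  rw [h]
  exact (Measurable.ite measurableSet_Ioi measurable_const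
    (Measurable.ite measurableSet_Iio measurable_const measurable_const)).comp hu

lemma abs_sign_le_one (t : ℝ) : |((SignType.sign t : SignType) : ℝ)| ≤ 1 := by
  rcases lt_trichotomy t 0 with h | h | h <;> simp [h]

/-- Pointwise Kato inequality: `sign a * a = |a|`, while `sign a * b ≤ |b|`. -/
lemma abs_sub_abs_le_sign_mul (a b : ℝ) :
    |a| - |b| ≤ ((SignType.sign a : SignType) : ℝ) * (a - b) := by
  rcases lt_trichotomy a 0 with h | h | h
  · simp [h, abs_of_neg h]; linarith [neg_abs_le b]
  · simp [h]
  · simp [h, abs_of_pos h]; linarith [le_abs_self b]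

/-- Kato's inequality, integrated against a nonnegative test function. -/
lemma integral_abs_mul_truncLap_le {u η : EuclideanSpace ℝ (Fin N) → ℝ}
    (hu : TailIntegrable q u) (hq : (N : ℝ) < q) (hε : 0 < ε) (hη : Continuous η)
    (hηc : HasCompactSupport η) (hη0 : ∀ x, 0 ≤ η x) :
    ∫ x, |u x| * truncLap q ε η x ≤ ∫ x, η x * (SignType.sign (u x) * truncLap q ε u x) := by
  have hq0 : 0 ≤ q := (Nat.cast_nonneg N).trans hq.le
  have hum := hu.measurable
  have hsm := measurable_sign_comp hum
  have hηm := hη.measurable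
  have hw : Continuous fun x : EuclideanSpace ℝ (Fin N) => (1 + ‖x‖) ^ q :=
    (continuous_const.add continuous_norm).rpow_const fun x => Or.inr hq0
  have hηw : Integrable fun x => η x * (1 + ‖x‖) ^ q :=
    (hη.mul hw).integrable_of_hasCompactSupport hηc.mul_right
  have hQ : ∀ v : EuclideanSpace ℝ (Fin N) × EuclideanSpace ℝ (Fin N) → ℝ, Measurable v →
      (∀ z, |v z| ≤ |u z.2|) →
      Integrable (fun z : EuclideanSpace ℝ (Fin N) × EuclideanSpace ℝ (Fin N) =>
        η z.1 * (truncKernel q ε (z.1 - z.2) * v z)) (volume.prod volume) := by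
    intro v hv hvu
    refine ((hηw.mul_prod hu.integrable).const_mul ((1 + 1 / ε) ^ q)).mono'
      (Measurable.aestronglyMeasurable (by fun_prop)) ?_
    filter_upwards with z
    rw [norm_mul, norm_mul, Real.norm_of_nonneg (truncKernel_nonneg _),
      Real.norm_of_nonneg (hη0 _), Real.norm_eq_abs]
    calc η z.1 * (truncKernel q ε (z.1 - z.2) * |v z|)
        ≤ η z.1 * ((1 + 1 / ε) ^ q * (1 + ‖z.1‖) ^ q * (1 + ‖z.2‖) ^ (-q) * |u z.2|) := by
          refine mul_le_mul_of_nonneg_left ?_ (hη0 _)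
          exact mul_le_mul (truncKernel_sub_le hq0 hε _ _) (hvu _) (abs_nonneg _) (by positivity)
      _ = _ := by ring
  -- Compact support of `η` pays for the growing weight: `η (1 + |x|)^(2q)` is bounded, and what is
  -- left is the tail weight `(1 + |x|)^(-q)`.
  have hηu : Integrable fun x => η x * (1 + ‖x‖) ^ q * |u x| := by
    obtain ⟨B, hB⟩ := (hη.mul (hw.mul hw)).bounded_above_of_compact_support hηc.mul_right
    refine (hu.integrable.const_mul B).mono' (by fun_prop) ?_
    filter_upwards with x
    have hx : (1 + ‖x‖) ^ q * (1 + ‖x‖) ^ (-q) = 1 := by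
      rw [← Real.rpow_add (by positivity)]; simp
    rw [Real.norm_of_nonneg (mul_nonneg (mul_nonneg (hη0 x) (by positivity)) (abs_nonneg _)),
      ← mul_assoc]
    refine mul_le_mul_of_nonneg_right ?_ (abs_nonneg _)
    calc η x * (1 + ‖x‖) ^ q
        = η x * ((1 + ‖x‖) ^ q * (1 + ‖x‖) ^ q) * (1 + ‖x‖) ^ (-q) := by
          rw [mul_assoc, mul_assoc, hx, mul_one]
      _ ≤ B * (1 + ‖x‖) ^ (-q) :=
          mul_le_mul_of_nonneg_right ((le_abs_self _).trans (hB x)) (by positivity)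
  have hJ : Integrable fun y : EuclideanSpace ℝ (Fin N) => (1 + ‖y‖) ^ (-q) :=
    integrable_one_add_norm (by simpa using hq)
  have hP : Integrable (fun z : EuclideanSpace ℝ (Fin N) × EuclideanSpace ℝ (Fin N) =>
        η z.1 * (truncKernel q ε (z.1 - z.2) * |u z.1|)) (volume.prod volume) := by
    refine ((hηu.mul_prod hJ).const_mul ((1 + 1 / ε) ^ q)).mono'
      (Measurable.aestronglyMeasurable (by fun_prop)) ?_
    filter_upwards with z
    rw [norm_mul, norm_mul, Real.norm_of_nonneg (truncKernel_nonneg _),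
      Real.norm_of_nonneg (hη0 _), Real.norm_eq_abs, abs_abs]
    calc η z.1 * (truncKernel q ε (z.1 - z.2) * |u z.1|)
        ≤ η z.1 * ((1 + 1 / ε) ^ q * (1 + ‖z.1‖) ^ q * (1 + ‖z.2‖) ^ (-q) * |u z.1|) := by
          refine mul_le_mul_of_nonneg_left ?_ (hη0 _)
          exact mul_le_mul_of_nonneg_right (truncKernel_sub_le hq0 hε _ _) (abs_nonneg _)
      _ = _ := by ring
  have hQ1 := hQ (fun z => |u z.2|) (by fun_prop) fun z => by simp
  have hQ2 := hQ (fun z => SignType.sign (u z.1) * u z.2)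
    ((hsm.comp measurable_fst).mul (by fun_prop)) fun z => by
      rw [abs_mul]
      exact mul_le_of_le_one_left (abs_nonneg _) (abs_sign_le_one _)
  have hsgn : ∀ t : ℝ, ((SignType.sign t : SignType) : ℝ) * t = |t| := sign_mul_self
  have hH : Integrable (fun z : EuclideanSpace ℝ (Fin N) × EuclideanSpace ℝ (Fin N) =>
      η z.1 * (SignType.sign (u z.1) * (truncKernel q ε (z.1 - z.2) * (u z.1 - u z.2))))
      (volume.prod volume) := by
    refine (hP.sub hQ2).congr ?_
    filter_upwards with z
    simp only [Pi.sub_apply, ← hsgn (u z.1)]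
    ring
  have hQs : Integrable (fun z : EuclideanSpace ℝ (Fin N) × EuclideanSpace ℝ (Fin N) =>
      η z.2 * (truncKernel q ε (z.2 - z.1) * |u z.1|)) (volume.prod volume) := hQ1.swap
  have hL : Integrable (fun z : EuclideanSpace ℝ (Fin N) × EuclideanSpace ℝ (Fin N) =>
      |u z.1| * (truncKernel q ε (z.1 - z.2) * (η z.1 - η z.2))) (volume.prod volume) := by
    refine (hP.sub hQs).congr ?_
    filter_upwards with z
    simp only [Pi.sub_apply, truncKernel_sub_comm z.2 z.1]
    ring
  calc ∫ x, |u x| * truncLap q ε η x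
      = ∫ z : EuclideanSpace ℝ (Fin N) × EuclideanSpace ℝ (Fin N),
          |u z.1| * (truncKernel q ε (z.1 - z.2) * (η z.1 - η z.2)) ∂(volume.prod volume) := by
        rw [integral_prod _ hL]
        simp_rw [integral_const_mul]
        rfl
    _ = (∫ z : EuclideanSpace ℝ (Fin N) × EuclideanSpace ℝ (Fin N),
          η z.1 * (truncKernel q ε (z.1 - z.2) * |u z.1|) ∂(volume.prod volume)) -
        ∫ z : EuclideanSpace ℝ (Fin N) × EuclideanSpace ℝ (Fin N),
          η z.2 * (truncKernel q ε (z.2 - z.1) * |u z.1|) ∂(volume.prod volume) := by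
        rw [← integral_sub hP hQs]
        refine integral_congr_ae ?_
        filter_upwards with z
        rw [truncKernel_sub_comm z.2 z.1]
        ring
    _ = (∫ z : EuclideanSpace ℝ (Fin N) × EuclideanSpace ℝ (Fin N),
          η z.1 * (truncKernel q ε (z.1 - z.2) * |u z.1|) ∂(volume.prod volume)) -
        ∫ z : EuclideanSpace ℝ (Fin N) × EuclideanSpace ℝ (Fin N),
          η z.1 * (truncKernel q ε (z.1 - z.2) * |u z.2|) ∂(volume.prod volume) := by
        -- Exchanging the variables uses the symmetry of the kernel; this is the integration by
        -- parts.
        rw [← integral_prod_swap (μ := volume) (ν := volume)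
          (fun z : EuclideanSpace ℝ (Fin N) × EuclideanSpace ℝ (Fin N) =>
            η z.1 * (truncKernel q ε (z.1 - z.2) * |u z.2|))]
        rfl
    _ = ∫ z : EuclideanSpace ℝ (Fin N) × EuclideanSpace ℝ (Fin N),
          (η z.1 * (truncKernel q ε (z.1 - z.2) * |u z.1|) -
          η z.1 * (truncKernel q ε (z.1 - z.2) * |u z.2|)) ∂(volume.prod volume) :=
        (integral_sub hP hQ1).symm
    _ ≤ ∫ z : EuclideanSpace ℝ (Fin N) × EuclideanSpace ℝ (Fin N),
          η z.1 * (SignType.sign (u z.1) * (truncKernel q ε (z.1 - z.2) * (u z.1 - u z.2)))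
          ∂(volume.prod volume) := by
        refine integral_mono (hP.sub hQ1) hH fun z => ?_
        simp only
        rw [← mul_sub, ← mul_sub, mul_left_comm ((SignType.sign (u z.1) : SignType) : ℝ)]
        exact mul_le_mul_of_nonneg_left (mul_le_mul_of_nonneg_left (abs_sub_abs_le_sign_mul _ _)
          (truncKernel_nonneg _)) (hη0 _)
    _ = ∫ x, η x * (SignType.sign (u x) * truncLap q ε u x) := by
        rw [integral_prod _ hH]
        simp_rw [integral_const_mul]
        rfl

/-! ### Scaling, Taylor bounds from Hölder regularity, and decay on bump functions -/

lemma truncLap_comp_inv_smul {r : ℝ} (hr : 0 < r) (η : EuclideanSpace ℝ (Fin N) → ℝ)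
    (x : EuclideanSpace ℝ (Fin N)) :
    truncLap q ε (fun y => η (r⁻¹ • y)) x =
      r ^ ((N : ℝ) - q) * truncLap q (ε / r) η (r⁻¹ • x) := by
  have hk : ∀ z : EuclideanSpace ℝ (Fin N),
      truncKernel q ε (r • z) = r ^ (-q) * truncKernel q (ε / r) z := by
    intro z
    simp only [truncKernel, norm_smul, Real.norm_of_nonneg hr.le, div_lt_iff₀ hr, mul_comm r ‖z‖]
    split_ifs
    · rw [Real.mul_rpow (norm_nonneg _) hr.le, mul_comm]
    · simp
  have h := Measure.integral_comp_smul_of_nonneg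
    (volume : Measure (EuclideanSpace ℝ (Fin N)))
    (fun y => truncKernel q ε (x - y) * (η (r⁻¹ • x) - η (r⁻¹ • y))) r (hR := hr.le)
  have h2 : ∀ y, truncKernel q ε (x - r • y) * (η (r⁻¹ • x) - η (r⁻¹ • r • y)) =
      r ^ (-q) * (truncKernel q (ε / r) (r⁻¹ • x - y) * (η (r⁻¹ • x) - η y)) := by
    intro y
    rw [inv_smul_smul₀ hr.ne', ← mul_assoc, ← hk, smul_sub, smul_inv_smul₀ hr.ne']
  simp_rw [h2] at h
  rw [integral_const_mul, finrank_euclideanSpace_fin, smul_eq_mul] at h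
  unfold truncLap
  rw [sub_eq_add_neg, Real.rpow_add hr, mul_assoc, h, Real.rpow_natCast,
    mul_inv_cancel_left₀ (pow_ne_zero _ hr.ne')]

lemma taylorBound_of_locHolder_fderiv {u : EuclideanSpace ℝ (Fin N) → ℝ} {β : ℝ} (hβ : 0 ≤ β)
    (hu : ContDiff ℝ 1 u) (hH : LocHolder β (fderiv ℝ u)) (r : ℝ) :
    ∃ C, 0 ≤ C ∧ TaylorBound r (1 + β) C u := by
  -- Radius `r + 1` contains every `x + z` with `|x| ≤ r`, `|z| ≤ 1`.
  obtain ⟨C, hC⟩ := hH (Metric.closedBall 0 (r + 1)) (isCompact_closedBall _ _)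
  refine ⟨C, C.2, fun x hx => ⟨fderiv ℝ u x, fun z hz => ?_⟩⟩
  have hmem : ∀ y ∈ Metric.closedBall x ‖z‖, y ∈ Metric.closedBall (0 : EuclideanSpace ℝ (Fin N))
      (r + 1) := by
    intro y hy
    rw [Metric.mem_closedBall, dist_eq_norm] at hy
    rw [mem_closedBall_zero_iff]
    calc ‖y‖ ≤ ‖x‖ + ‖y - x‖ := norm_le_norm_add_norm_sub' _ _
      _ ≤ r + 1 := add_le_add hx (hy.trans hz)
  have h := (convex_closedBall x ‖z‖).norm_image_sub_le_of_norm_fderiv_le' (𝕜 := ℝ) (f := u)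
    (φ := fderiv ℝ u x) (C := C * ‖z‖ ^ β) (x := x) (y := x + z)
    (fun y _ => (hu.differentiable one_ne_zero) y) (fun y hy => ?_)
    (Metric.mem_closedBall_self (norm_nonneg z)) (by simp)
  · rw [add_sub_cancel_left, Real.norm_eq_abs, mul_assoc] at h
    refine h.trans (mul_le_mul_of_nonneg_left ?_ C.2)
    rcases eq_or_ne z 0 with rfl | hz0
    · simp; positivity
    · rw [Real.rpow_add (norm_pos_iff.2 hz0), Real.rpow_one, mul_comm]
  · have hd := hC.dist_le_of_le (hmem y hy)
      (hmem x (Metric.mem_closedBall_self (norm_nonneg z))) hy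
    rwa [dist_eq_norm, Real.coe_toNNReal _ hβ] at hd

lemma taylorBound_of_locHolder {u : EuclideanSpace ℝ (Fin N) → ℝ} {β : ℝ} (hβ : 0 ≤ β)
    (hH : LocHolder β u) (r : ℝ) :
    ∃ C, 0 ≤ C ∧ TaylorBound r β C u := by
  obtain ⟨C, hC⟩ := hH (Metric.closedBall 0 (r + 1)) (isCompact_closedBall _ _)
  refine ⟨C, C.2, fun x hx => ⟨0, fun z hz => ?_⟩⟩
  have hd := hC.dist_le_of_le (x := x + z) (y := x) (d := ‖z‖)
    (mem_closedBall_zero_iff.2 ((norm_add_le _ _).trans (add_le_add hx hz)))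
    (mem_closedBall_zero_iff.2 (by linarith)) (by simp)
  rw [dist_eq_norm, Real.coe_toNNReal _ hβ, Real.norm_eq_abs] at hd
  simpa using hd

/-- The strict excess `β > 2s`, supplied by `γ`, is the condition `β > q - N` at `q = N + 2s`. -/
lemma FracRegular.exists_taylorBound {s : ℝ} (hs : 0 < s) {u : EuclideanSpace ℝ (Fin N) → ℝ}
    (hu : FracRegular s u) :
    ∃ β, 2 * s < β ∧ ∀ r, ∃ C, 0 ≤ C ∧ TaylorBound r β C u := by
  obtain ⟨γ, hγ, h1, h2⟩ := hu
  rcases lt_or_ge s (1 / 2) with h | h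
  · exact ⟨2 * s + γ, by linarith, taylorBound_of_locHolder (by linarith) (h1 h).2⟩
  · obtain ⟨-, hd, hH⟩ := h2 h
    exact ⟨1 + (2 * s + γ - 1), by linarith,
      taylorBound_of_locHolder_fderiv (by linarith) hd hH⟩

lemma FracRegular.continuous {s : ℝ} (hs : 0 < s) {u : EuclideanSpace ℝ (Fin N) → ℝ}
    (hu : FracRegular s u) : Continuous u := by
  obtain ⟨γ, hγ, h1, h2⟩ := hu
  rcases lt_or_ge s (1 / 2) with h | h
  · rw [continuous_iff_continuousAt]
    intro x
    obtain ⟨C, hC⟩ := (h1 h).2 (Metric.closedBall x 1) (isCompact_closedBall _ _)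
    exact (hC.continuousOn (Real.toNNReal_pos.2 (by linarith))).continuousAt
      (Metric.closedBall_mem_nhds x one_pos)
  · exact (h2 h).2.1.continuous

lemma TailIntegrable.of_continuous {η : EuclideanSpace ℝ (Fin N) → ℝ} (hη : Continuous η)
    (hηc : HasCompactSupport η) : TailIntegrable q η := by
  refine ⟨hη.measurable, Continuous.integrable_of_hasCompactSupport ?_ ?_⟩
  · exact ((continuous_const.add continuous_norm).rpow_const fun x =>
      Or.inl (by positivity : (0 : ℝ) < 1 + ‖x‖).ne').mul hη.abs
  · exact (hηc.comp_left (g := fun t : ℝ => |t|) abs_zero).mul_left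

/-- Far from the support of a compactly supported function the truncated operator decays like
the kernel. -/
lemma abs_truncLap_le_of_support {η : EuclideanSpace ℝ (Fin N) → ℝ} {R : ℝ} (hq : 0 ≤ q)
    (hR : 1 ≤ R) (hη : Continuous η) (hηc : HasCompactSupport η)
    (hsupp : ∀ x, R ≤ ‖x‖ → η x = 0) {x : EuclideanSpace ℝ (Fin N)} (hx : 2 * R ≤ ‖x‖) :
    |truncLap q ε η x| ≤ 4 ^ q * (∫ y, |η y|) * (1 + ‖x‖) ^ (-q) := by
  have hx0 : 0 < ‖x‖ := by linarith
  rw [mul_right_comm, ← integral_const_mul, ← Real.norm_eq_abs, truncLap]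
  refine norm_integral_le_of_norm_le
    ((hη.integrable_of_hasCompactSupport hηc).abs.const_mul _) ?_
  filter_upwards with y
  rw [hsupp x (by linarith), zero_sub, norm_mul, norm_neg, Real.norm_eq_abs (η y),
    Real.norm_of_nonneg (truncKernel_nonneg _)]
  rcases le_or_gt R ‖y‖ with hy | hy
  · simp [hsupp y hy]
  refine mul_le_mul_of_nonneg_right ?_ (abs_nonneg _)
  unfold truncKernel
  split_ifs
  -- Here `|y| < R ≤ |x|/2`, so `|x - y| ≥ |x|/2`, and `1 + |x| ≤ 2|x|` since `|x| ≥ 2`.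
  · have h1 : 1 + ‖x‖ ≤ 4 * ‖x - y‖ := by
      have := norm_sub_norm_le x y
      linarith
    have h2 : 0 < ‖x - y‖ := by linarith
    rw [Real.rpow_neg h2.le, Real.rpow_neg (by positivity), ← div_eq_mul_inv,
      inv_le_comm₀ (by positivity) (by positivity), inv_div, div_le_iff₀ (by positivity), mul_comm,
      ← Real.mul_rpow (by positivity) (by positivity)]
    exact Real.rpow_le_rpow (by positivity) h1 hq
  · positivity

lemma exists_bump_abs_truncLap_le (hN : 1 ≤ N) (hq : (N : ℝ) < q) (hq2 : q < N + 2) :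
    ∃ η : EuclideanSpace ℝ (Fin N) → ℝ, Continuous η ∧ HasCompactSupport η ∧ (∀ x, 0 ≤ η x) ∧
      (∀ x, ‖x‖ ≤ 1 → η x = 1) ∧ ∃ C, 0 ≤ C ∧ ∀ ε, 0 < ε → ε ≤ 1 → ∀ x,
        |truncLap q ε η x| ≤ C * (1 + ‖x‖) ^ (-q) := by
  have hq0 : 0 ≤ q := (Nat.cast_nonneg N).trans hq.le
  let η : ContDiffBump (0 : EuclideanSpace ℝ (Fin N)) := ⟨1, 2, one_pos, one_lt_two⟩
  have hd : ContDiff ℝ 2 η := η.contDiff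
  have hf : ContDiff ℝ 1 (fderiv ℝ η) := hd.fderiv_right (by norm_num)
  have hH : LocHolder 1 (fderiv ℝ η) := by
    obtain ⟨C, hC⟩ := hf.lipschitzWith_of_hasCompactSupport (η.hasCompactSupport.fderiv ℝ)
      one_ne_zero
    intro K _
    refine ⟨C, ?_⟩
    rw [Real.toNNReal_one]
    exact hC.holderWith.holderOnWith K
  obtain ⟨C, hC, hT⟩ := taylorBound_of_locHolder_fderiv zero_le_one (hd.of_le (by norm_num)) hH 4
  have htail : TailIntegrable q η := TailIntegrable.of_continuous η.continuous η.hasCompactSupport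
  obtain ⟨B, hB⟩ := exists_abs_truncLap_le (M := 1) htail hN hq (by linarith) hT hC fun x _ => by
    rw [abs_of_nonneg η.nonneg]; exact η.le_one
  have hη2 : ∀ x, 2 ≤ ‖x‖ → η x = 0 := fun x hx => η.zero_of_le_dist (by simpa using hx)
  have hB0 : 0 ≤ B := (abs_nonneg _).trans (hB 0 (by simp) 1 one_pos le_rfl)
  have hI0 : 0 ≤ ∫ y, |η y| := integral_nonneg fun _ => abs_nonneg _
  -- The bump vanishes for `|x| ≥ 2`, so the far-field bound covers `|x| > 4`; on `|x| ≤ 4` the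
  -- bound `B` is used with `1 + |x| ≤ 5`, whence `5 ^ q`.
  refine ⟨η, η.continuous, η.hasCompactSupport, fun x => η.nonneg,
    fun x hx => η.one_of_mem_closedBall (by simpa using hx), 5 ^ q * B + 4 ^ q * ∫ y, |η y|,
    by positivity, fun ε hε0 hε1 x => ?_⟩
  rw [add_mul]
  rcases le_or_gt ‖x‖ 4 with hx | hx
  · refine le_add_of_le_of_nonneg ((hB x hx ε hε0 hε1).trans ?_) (by positivity)
    rw [mul_right_comm]
    refine le_mul_of_one_le_left hB0 ?_
    rw [Real.rpow_neg (by positivity), ← div_eq_mul_inv, one_le_div (by positivity)]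
    exact Real.rpow_le_rpow (by positivity) (by linarith) hq0
  · exact le_add_of_nonneg_of_le (by positivity) (abs_truncLap_le_of_support hq0 one_le_two
      η.continuous η.hasCompactSupport hη2 (by linarith))

/-! ### The localized estimate for solutions -/

lemma hasFracLaplacianAt_iff {s : ℝ} {u : EuclideanSpace ℝ (Fin N) → ℝ} {L : ℝ}
    {x : EuclideanSpace ℝ (Fin N)} :
    HasFracLaplacianAt s u L x ↔
      Tendsto (fun ε => fracConst N s * truncLap (N + 2 * s) ε u x) (𝓝[>] 0) (𝓝 L) := by
  have h : ∀ ε, truncLap (N + 2 * s) ε u x =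
      ∫ y in {y | ε < ‖x - y‖}, (u x - u y) / ‖x - y‖ ^ ((N : ℝ) + 2 * s) := by
    intro ε
    rw [truncLap, ← integral_indicator (measurableSet_lt measurable_const (by fun_prop))]
    refine integral_congr_ae ?_
    filter_upwards with y
    simp only [truncKernel, indicator, mem_ofPred_eq]
    split_ifs
    · rw [Real.rpow_neg (norm_nonneg _), div_eq_mul_inv, mul_comm]
    · simp
  simp only [HasFracLaplacianAt, h]

lemma fracConst_pos {s : ℝ} (hs0 : 0 < s) (hs1 : s < 1) : 0 < fracConst N s := by
  have h1 : 0 < Real.Gamma (((N : ℝ) + 2 * s) / 2) := Real.Gamma_pos_of_pos (by positivity)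
  have h2 : 0 < Real.Gamma (1 - s) := Real.Gamma_pos_of_pos (by linarith)
  have := Real.pi_pos
  unfold fracConst
  positivity

lemma one_add_norm_div_rpow_neg_le (hq : 0 ≤ q) {r : ℝ} (hr : 1 ≤ r)
    (x : EuclideanSpace ℝ (Fin N)) :
    (1 + ‖x‖ / r) ^ (-q) ≤ r ^ q * (1 + ‖x‖) ^ (-q) := by
  have hr0 : 0 < r := by linarith
  rw [Real.rpow_neg (by positivity), Real.rpow_neg (by positivity), ← div_eq_mul_inv,
    inv_le_comm₀ (by positivity) (by positivity), inv_div, ← Real.div_rpow (by positivity) hr0.le]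
  refine Real.rpow_le_rpow (by positivity) ?_ hq
  rw [add_div]
  exact add_le_add ((div_le_one hr0).2 hr) le_rfl

lemma TailIntegrable.integrable_scaled {u : EuclideanSpace ℝ (Fin N) → ℝ}
    (hu : TailIntegrable q u) (hq : 0 ≤ q) {r : ℝ} (hr : 1 ≤ r) :
    Integrable (fun x => (1 + ‖x‖ / r) ^ (-q) * |u x|) := by
  have hr0 : 0 < r := by linarith
  have hm := hu.measurable
  refine (hu.integrable.const_mul (r ^ q)).mono' (Measurable.aestronglyMeasurable
    (((measurable_norm.div_const r).const_add 1).pow_const _ |>.mul hm.abs)) ?_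
  filter_upwards with x
  rw [Real.norm_of_nonneg (by positivity), ← mul_assoc]
  exact mul_le_mul_of_nonneg_right (one_add_norm_div_rpow_neg_le hq hr x) (abs_nonneg _)

/-- Testing the equation with the rescaled bump functions. -/
lemma IsSolution.exists_setIntegral_closedBall_le {s : ℝ} (hs0 : 0 < s) (hs1 : s < 1)
    (hN : 1 ≤ N) {ρ c u : EuclideanSpace ℝ (Fin N) → ℝ} (hρ : Continuous ρ) (hc : Continuous c)
    (hρ0 : ∀ x, 0 ≤ ρ x) (hc0 : ∀ x, 0 ≤ c x) (hu : IsSolution s ρ c u)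
    (htail : TailIntegrable (N + 2 * s) u) :
    ∃ C, 0 ≤ C ∧ ∀ r, 1 ≤ r → ∫ x in Metric.closedBall 0 r, ρ x * c x * |u x| ≤
      C * r ^ (-(2 * s)) * ∫ x, (1 + ‖x‖ / r) ^ (-((N : ℝ) + 2 * s)) * |u x| := by
  set q : ℝ := N + 2 * s with hqdef
  have hq : (N : ℝ) < q := by linarith
  have hq0 : 0 ≤ q := (Nat.cast_nonneg N).trans hq.le
  obtain ⟨η, hη, hηc, hη0, hη1, C, hC, hηC⟩ :=
    exists_bump_abs_truncLap_le (N := N) hN hq (by linarith)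
  have hF := fracConst_pos (N := N) hs0 hs1
  have hucont := hu.regular.continuous hs0
  obtain ⟨β, hβ, hTay⟩ := hu.regular.exists_taylorBound hs0
  refine ⟨fracConst N s * C, by positivity, fun r hr => ?_⟩
  have hr0 : 0 < r := by linarith
  set ηr : EuclideanSpace ℝ (Fin N) → ℝ := fun x => η (r⁻¹ • x) with hηr
  have hcr : Continuous ηr := hη.comp (continuous_const_smul _)
  have hcc : HasCompactSupport ηr := hηc.comp_smul (inv_ne_zero hr0.ne')
  -- the lower bound before the limit
  have hlow : ∀ ε, 0 < ε → ε ≤ 1 →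
      -(fracConst N s * C * r ^ (-(2 * s)) * ∫ x, (1 + ‖x‖ / r) ^ (-q) * |u x|) ≤
      ∫ x, ηr x * (SignType.sign (u x) * (fracConst N s * truncLap q ε u x)) := by
    intro ε hε0 hε1
    have h1 := integral_abs_mul_truncLap_le htail hq hε0 hcr hcc fun x => hη0 _
    have h2 : |∫ x, |u x| * truncLap q ε ηr x| ≤
        ∫ x, C * r ^ (-(2 * s)) * ((1 + ‖x‖ / r) ^ (-q) * |u x|) := by
      rw [← Real.norm_eq_abs]
      refine norm_integral_le_of_norm_le ((htail.integrable_scaled hq0 hr).const_mul _) ?_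
      filter_upwards with x
      rw [norm_mul, Real.norm_eq_abs, Real.norm_eq_abs, abs_abs, truncLap_comp_inv_smul hr0,
        abs_mul, abs_of_nonneg (by positivity : 0 ≤ r ^ ((N : ℝ) - q)),
        show (N : ℝ) - q = -(2 * s) by rw [hqdef]; ring]
      -- Scaling changes the truncation to `ε / r`, still at most `1` because `r ≥ 1`.
      have h3 := hηC (ε / r) (by positivity) ((div_le_one hr0).2 (hε1.trans hr)) (r⁻¹ • x)
      rw [norm_smul, norm_inv, Real.norm_of_nonneg hr0.le, ← div_eq_inv_mul] at h3
      calc |u x| * (r ^ (-(2 * s)) * |truncLap q (ε / r) η (r⁻¹ • x)|)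
          ≤ |u x| * (r ^ (-(2 * s)) * (C * (1 + ‖x‖ / r) ^ (-q))) := by gcongr
        _ = _ := by ring
    rw [integral_const_mul] at h2
    have h4 : ∫ x, ηr x * (SignType.sign (u x) * (fracConst N s * truncLap q ε u x)) =
        fracConst N s * ∫ x, ηr x * (SignType.sign (u x) * truncLap q ε u x) := by
      rw [← integral_const_mul]
      refine integral_congr_ae ?_
      filter_upwards with x
      ring
    rw [h4, mul_assoc, mul_assoc, ← mul_neg, ← mul_assoc C]
    exact mul_le_mul_of_nonneg_left ((neg_le_of_abs_le h2).trans h1) hF.le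
  -- passage to the limit
  obtain ⟨R, hR⟩ := hcc.isCompact.isBounded.subset_closedBall 0
  obtain ⟨CT, hCT0, hCT⟩ := hTay R
  obtain ⟨M, hM⟩ := (isCompact_closedBall (0 : EuclideanSpace ℝ (Fin N)) R).exists_bound_of_continuousOn
    hucont.continuousOn
  -- A bound uniform in `ε` on a ball containing the support of the bump; it provides the dominating
  -- function.
  obtain ⟨B, hB⟩ := exists_abs_truncLap_le htail hN hq (by linarith) hCT hCT0
    (fun x hx => hM x (by simpa using hx))
  have hlim : Tendsto
      (fun ε => ∫ x, ηr x * (SignType.sign (u x) * (fracConst N s * truncLap q ε u x)))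
      (𝓝[>] 0) (𝓝 (∫ x, ηr x * (SignType.sign (u x) * (-(ρ x * c x * u x))))) := by
    refine tendsto_integral_filter_of_dominated_convergence
      (fun x => ηr x * (fracConst N s * B)) ?_ ?_ ?_ ?_
    · filter_upwards with ε
      exact (hcr.measurable.mul ((measurable_sign_comp htail.measurable).mul
        ((measurable_truncLap htail.measurable).const_mul _))).aestronglyMeasurable
    · filter_upwards [Ioc_mem_nhdsGT (zero_lt_one (α := ℝ))] with ε hε
      filter_upwards with x
      rw [norm_mul, Real.norm_of_nonneg (show 0 ≤ ηr x from hη0 _)]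
      by_cases hx : x ∈ tsupport ηr
      · refine mul_le_mul_of_nonneg_left ?_ (hη0 _)
        rw [norm_mul, norm_mul, Real.norm_of_nonneg hF.le]
        refine (mul_le_of_le_one_left (by positivity) (abs_sign_le_one _)).trans ?_
        exact mul_le_mul_of_nonneg_left (hB x (by simpa using hR hx) ε hε.1 hε.2) hF.le
      · have : ηr x = 0 := image_eq_zero_of_notMem_tsupport hx
        rw [this, zero_mul, zero_mul]
    · exact (hcr.integrable_of_hasCompactSupport hcc).mul_const _
    · filter_upwards with x
      exact ((hasFracLaplacianAt_iff.1 (hu.equation x)).const_mul _).const_mul _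
  have hfinal := ge_of_tendsto hlim (by
    filter_upwards [Ioc_mem_nhdsGT (zero_lt_one (α := ℝ))] with ε hε
    exact hlow ε hε.1 hε.2)
  have heq : ∫ x, ηr x * (SignType.sign (u x) * (-(ρ x * c x * u x))) =
      -∫ x, ηr x * (ρ x * c x * |u x|) := by
    rw [← integral_neg]
    refine integral_congr_ae ?_
    filter_upwards with x
    rw [← sign_mul_self (u x)]
    ring
  rw [heq] at hfinal
  refine le_trans ?_ (neg_le_neg_iff.1 hfinal)
  rw [← integral_indicator measurableSet_closedBall]
  have hV : Continuous fun x => ρ x * c x * |u x| := (hρ.mul hc).mul hucont.abs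
  have hV0 : ∀ x, 0 ≤ ρ x * c x * |u x| := fun x =>
    mul_nonneg (mul_nonneg (hρ0 x) (hc0 x)) (abs_nonneg _)
  refine integral_mono ?_ ((hcr.mul hV).integrable_of_hasCompactSupport hcc.mul_right) fun x => ?_
  · exact (integrable_indicator_iff measurableSet_closedBall).2
      (hV.continuousOn.integrableOn_compact (isCompact_closedBall _ _))
  · refine indicator_apply_le' (fun hx => ?_) fun _ => mul_nonneg (hη0 _) (hV0 x)
    have h1 : ηr x = 1 := by
      refine hη1 _ ?_
      rw [norm_smul, norm_inv, Real.norm_of_nonneg hr0.le, ← div_eq_inv_mul, div_le_one hr0]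
      simpa using hx
    rw [h1, one_mul]

/-! ### Dyadic summation and absorption -/

/-- The factor `(m + t)^(-(N+2s))` is split as `(1 + t)^(-N)` times `m^(-2s)`. The remaining powers
of `m` combine to `m^(-2(s-a))`, summable over `m = 2^k` when `a < s`. -/
lemma rpow_dyadic_le {N a s R m t : ℝ} (hN : 0 ≤ N) (hs : 0 ≤ s) (hR : 0 < R)
    (hm : 1 ≤ m) (ht : 0 ≤ t) :
    m ^ (-(N - 2 * a)) * (R * m) ^ (-(2 * s)) * (1 + t / m) ^ (-(N + 2 * s)) ≤
      R ^ (-(2 * s)) * (m ^ (-(2 * (s - a))) * (1 + t) ^ (-N)) := by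
  have hm0 : 0 < m := by linarith
  have h1 : (1 + t / m) = (m + t) * m⁻¹ := by field_simp
  have h2 : (m + t) ^ (-(N + 2 * s)) ≤ (1 + t) ^ (-N) * m ^ (-(2 * s)) := by
    rw [neg_add, Real.rpow_add (by positivity)]
    exact mul_le_mul
      (Real.rpow_le_rpow_of_nonpos (by positivity) (by linarith) (by linarith))
      (Real.rpow_le_rpow_of_nonpos hm0 (by linarith) (by linarith)) (by positivity) (by positivity)
  rw [h1, Real.mul_rpow hR.le hm0.le, Real.mul_rpow (by positivity) (by positivity),
    Real.inv_rpow hm0.le, ← Real.rpow_neg hm0.le, neg_neg]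
  calc m ^ (-(N - 2 * a)) * (R ^ (-(2 * s)) * m ^ (-(2 * s))) *
        ((m + t) ^ (-(N + 2 * s)) * m ^ (N + 2 * s))
      ≤ m ^ (-(N - 2 * a)) * (R ^ (-(2 * s)) * m ^ (-(2 * s))) *
        ((1 + t) ^ (-N) * m ^ (-(2 * s)) * m ^ (N + 2 * s)) := by gcongr
    _ = R ^ (-(2 * s)) * ((m ^ (-(N - 2 * a)) * m ^ (-(2 * s)) * m ^ (-(2 * s)) *
        m ^ (N + 2 * s)) * (1 + t) ^ (-N)) := by ring
    _ = _ := by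
        rw [← Real.rpow_add hm0, ← Real.rpow_add hm0, ← Real.rpow_add hm0]
        ring_nf

/-- Since `R(1 + t/R) = R + t ≥ 1 + t`, the power `2a` of the scaled weight is traded for the
unscaled one, at the cost of `R^(2a)`. -/
lemma rpow_absorb_le {N a s R t : ℝ} (ha : 0 ≤ a) (hR : 1 ≤ R) (ht : 0 ≤ t) :
    R ^ (-(2 * s)) * (1 + t / R) ^ (-N) ≤
      R ^ (-(2 * (s - a))) * ((1 + t / R) ^ (-(N - 2 * a)) * (1 + t) ^ (-(2 * a))) := by
  have hR0 : 0 < R := by linarith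
  have h1 : (R * (1 + t / R)) ^ (-(2 * a)) ≤ (1 + t) ^ (-(2 * a)) := by
    refine Real.rpow_le_rpow_of_nonpos (by positivity) ?_ (by linarith)
    rw [mul_add, mul_one, mul_div_cancel₀ _ hR0.ne']
    linarith
  rw [Real.mul_rpow hR0.le (by positivity)] at h1
  calc R ^ (-(2 * s)) * (1 + t / R) ^ (-N)
      = R ^ (-(2 * (s - a))) * ((1 + t / R) ^ (-(N - 2 * a)) *
        (R ^ (-(2 * a)) * (1 + t / R) ^ (-(2 * a)))) := by
        rw [show -(2 * s) = -(2 * (s - a)) + -(2 * a) by ring,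
          show -N = -(N - 2 * a) + -(2 * a) by ring, Real.rpow_add hR0,
          Real.rpow_add (by positivity)]
        ring
    _ ≤ _ := by gcongr

lemma exists_two_pow_between {t : ℝ} (ht : 0 ≤ t) :
    ∃ k : ℕ, t ≤ 2 ^ k ∧ (2 : ℝ) ^ k ≤ 2 * (1 + t) := by
  obtain ⟨k, h1, h2⟩ := exists_nat_pow_near (x := 1 + t) (y := 2) (by linarith) one_lt_two
  exact ⟨k + 1, by linarith, by rw [pow_succ]; linarith⟩

lemma exists_tsum_dyadic_eq {δ : ℝ} (hδ : 0 < δ) :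
    ∃ S : ℝ, 0 ≤ S ∧ ∑' k : ℕ, ENNReal.ofReal (((2 : ℝ) ^ k) ^ (-(2 * δ))) = ENNReal.ofReal S := by
  have h : ∀ k : ℕ, ((2 : ℝ) ^ k) ^ (-(2 * δ)) = ((2 : ℝ) ^ (-(2 * δ))) ^ k := by
    intro k
    rw [← Real.rpow_natCast, ← Real.rpow_natCast, ← Real.rpow_mul two_pos.le,
      ← Real.rpow_mul two_pos.le, mul_comm]
  have hlt : (2 : ℝ) ^ (-(2 * δ)) < 1 := Real.rpow_lt_one_of_one_lt_of_neg one_lt_two (by linarith)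
  refine ⟨∑' k : ℕ, ((2 : ℝ) ^ k) ^ (-(2 * δ)), tsum_nonneg fun k => by positivity, ?_⟩
  rw [ENNReal.ofReal_tsum_of_nonneg (fun k => by positivity)]
  simp_rw [h]
  exact summable_geometric_of_lt_one (by positivity) hlt

/-- Summing the localized estimate over dyadic balls. -/
lemma lintegral_dyadic_le {a s C R : ℝ} (ha : 0 ≤ a) (has : a < s) (hN : 2 * a ≤ N) (hC : 0 ≤ C)
    {S : ℝ} (hS0 : 0 ≤ S)
    (hS : ∑' k : ℕ, ENNReal.ofReal (((2 : ℝ) ^ k) ^ (-(2 * (s - a)))) = ENNReal.ofReal S)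
    {w : EuclideanSpace ℝ (Fin N) → ENNReal} (hw : Measurable w)
    (hloc : ∀ r, 1 ≤ r →
      ∫⁻ x in Metric.closedBall 0 r, ENNReal.ofReal ((1 + ‖x‖) ^ (-(2 * a))) * w x ≤
      ENNReal.ofReal (C * r ^ (-(2 * s))) *
        ∫⁻ x, ENNReal.ofReal ((1 + ‖x‖ / r) ^ (-((N : ℝ) + 2 * s))) * w x) (hR : 1 ≤ R) :
    ENNReal.ofReal (2 ^ (-((N : ℝ) - 2 * a))) *
      ∫⁻ x, ENNReal.ofReal ((1 + ‖x‖ / R) ^ (-((N : ℝ) - 2 * a)) * (1 + ‖x‖) ^ (-(2 * a))) * w x ≤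
    ENNReal.ofReal (C * S * R ^ (-(2 * (s - a)))) *
      ∫⁻ x, ENNReal.ofReal
        ((1 + ‖x‖ / R) ^ (-((N : ℝ) - 2 * a)) * (1 + ‖x‖) ^ (-(2 * a))) * w x := by
  set b : ℝ := N - 2 * a with hb
  have hb0 : 0 ≤ b := by linarith
  have hR0 : 0 < R := by linarith
  have hVw : Measurable fun x => ENNReal.ofReal ((1 + ‖x‖) ^ (-(2 * a))) * w x :=
    ((measurable_norm.const_add 1).pow_const _).ennreal_ofReal.mul hw
  have hlow : ∀ x : EuclideanSpace ℝ (Fin N),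
      ENNReal.ofReal (2 ^ (-b)) *
        (ENNReal.ofReal ((1 + ‖x‖ / R) ^ (-b) * (1 + ‖x‖) ^ (-(2 * a))) * w x) ≤
      ∑' k : ℕ, ENNReal.ofReal (((2 : ℝ) ^ k) ^ (-b)) *
        (Metric.closedBall 0 (R * 2 ^ k)).indicator
          (fun x => ENNReal.ofReal ((1 + ‖x‖) ^ (-(2 * a))) * w x) x := by
    intro x
    -- One term of the series is enough: the first ball containing `x`, up to a factor `2`, already
    -- has the required weight.
    obtain ⟨k, hk1, hk2⟩ := exists_two_pow_between (t := ‖x‖ / R) (by positivity)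
    refine le_trans ?_ (ENNReal.le_tsum k)
    rw [indicator_of_mem (by simpa [mul_comm] using (div_le_iff₀ hR0).1 hk1),
      ENNReal.ofReal_mul (by positivity), mul_assoc, ← mul_assoc, ← ENNReal.ofReal_mul (by positivity),
      ← Real.mul_rpow (by positivity) (by positivity)]
    gcongr ENNReal.ofReal ?_ * _
    exact Real.rpow_le_rpow_of_nonpos (by positivity) hk2 (by linarith)
  have hup : ∀ k : ℕ, ENNReal.ofReal (((2 : ℝ) ^ k) ^ (-b)) *
      ∫⁻ x in Metric.closedBall 0 (R * 2 ^ k), ENNReal.ofReal ((1 + ‖x‖) ^ (-(2 * a))) * w x ≤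
      ENNReal.ofReal (((2 : ℝ) ^ k) ^ (-(2 * (s - a)))) * (ENNReal.ofReal (C * R ^ (-(2 * s))) *
        ∫⁻ x, ENNReal.ofReal ((1 + ‖x‖ / R) ^ (-(N : ℝ))) * w x) := by
    intro k
    have hk1 : (1 : ℝ) ≤ 2 ^ k := one_le_pow₀ one_le_two
    refine (mul_le_mul_right (hloc (R * 2 ^ k) (one_le_mul_of_one_le_of_one_le hR hk1)) _).trans ?_
    simp only [← lintegral_const_mul' _ _ ENNReal.ofReal_ne_top]
    refine lintegral_mono fun x => ?_
    simp only [← mul_assoc]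
    rw [← ENNReal.ofReal_mul (by positivity), ← ENNReal.ofReal_mul (by positivity),
      ← ENNReal.ofReal_mul (by positivity), ← ENNReal.ofReal_mul (by positivity)]
    gcongr ENNReal.ofReal ?_ * _
    have h := rpow_dyadic_le (N := N) (a := a) (s := s) (R := R) (m := 2 ^ k) (t := ‖x‖ / R)
      (Nat.cast_nonneg N) (by linarith) hR0 hk1 (by positivity)
    rw [div_div] at h
    calc ((2 : ℝ) ^ k) ^ (-b) * (C * (R * 2 ^ k) ^ (-(2 * s))) *
          (1 + ‖x‖ / (R * 2 ^ k)) ^ (-((N : ℝ) + 2 * s))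
        = C * (((2 : ℝ) ^ k) ^ (-b) * (R * 2 ^ k) ^ (-(2 * s)) *
          (1 + ‖x‖ / (R * 2 ^ k)) ^ (-((N : ℝ) + 2 * s))) := by ring
      _ ≤ _ := mul_le_mul_of_nonneg_left h hC
      _ = _ := by ring
  calc ENNReal.ofReal (2 ^ (-b)) *
        ∫⁻ x, ENNReal.ofReal ((1 + ‖x‖ / R) ^ (-b) * (1 + ‖x‖) ^ (-(2 * a))) * w x
      = ∫⁻ x, ENNReal.ofReal (2 ^ (-b)) *
        (ENNReal.ofReal ((1 + ‖x‖ / R) ^ (-b) * (1 + ‖x‖) ^ (-(2 * a))) * w x) :=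
        (lintegral_const_mul' _ _ ENNReal.ofReal_ne_top).symm
    _ ≤ ∫⁻ x, ∑' k : ℕ, ENNReal.ofReal (((2 : ℝ) ^ k) ^ (-b)) *
        (Metric.closedBall 0 (R * 2 ^ k)).indicator
          (fun x => ENNReal.ofReal ((1 + ‖x‖) ^ (-(2 * a))) * w x) x := lintegral_mono hlow
    _ = ∑' k : ℕ, ENNReal.ofReal (((2 : ℝ) ^ k) ^ (-b)) *
        ∫⁻ x in Metric.closedBall 0 (R * 2 ^ k),
          ENNReal.ofReal ((1 + ‖x‖) ^ (-(2 * a))) * w x := by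
        rw [lintegral_tsum fun k => ((hVw.indicator measurableSet_closedBall).const_mul
          _).aemeasurable]
        refine tsum_congr fun k => ?_
        rw [lintegral_const_mul' _ _ ENNReal.ofReal_ne_top,
          lintegral_indicator measurableSet_closedBall]
    _ ≤ ∑' k : ℕ, ENNReal.ofReal (((2 : ℝ) ^ k) ^ (-(2 * (s - a)))) *
        (ENNReal.ofReal (C * R ^ (-(2 * s))) *
        ∫⁻ x, ENNReal.ofReal ((1 + ‖x‖ / R) ^ (-(N : ℝ))) * w x) := ENNReal.tsum_le_tsum hup
    _ = ∫⁻ x, ENNReal.ofReal (S * (C * R ^ (-(2 * s)))) *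
          (ENNReal.ofReal ((1 + ‖x‖ / R) ^ (-(N : ℝ))) * w x) := by
        rw [ENNReal.tsum_mul_right, hS, ← mul_assoc, ← ENNReal.ofReal_mul hS0,
          lintegral_const_mul' _ _ ENNReal.ofReal_ne_top]
    _ ≤ ∫⁻ x, ENNReal.ofReal (C * S * R ^ (-(2 * (s - a)))) *
        (ENNReal.ofReal ((1 + ‖x‖ / R) ^ (-b) * (1 + ‖x‖) ^ (-(2 * a))) * w x) := by
        refine lintegral_mono fun x => ?_
        simp only [← mul_assoc]
        rw [← ENNReal.ofReal_mul (by positivity), ← ENNReal.ofReal_mul (by positivity)]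
        gcongr ENNReal.ofReal ?_ * _
        have h := rpow_absorb_le (N := N) (a := a) (s := s) (R := R) (t := ‖x‖) ha hR
          (norm_nonneg x)
        calc S * C * R ^ (-(2 * s)) * (1 + ‖x‖ / R) ^ (-(N : ℝ))
            = C * S * (R ^ (-(2 * s)) * (1 + ‖x‖ / R) ^ (-(N : ℝ))) := by ring
          _ ≤ C * S * (R ^ (-(2 * (s - a))) *
              ((1 + ‖x‖ / R) ^ (-(N - 2 * a)) * (1 + ‖x‖) ^ (-(2 * a)))) := by gcongr
          _ = _ := by ring
    _ = _ := lintegral_const_mul' _ _ ENNReal.ofReal_ne_top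

/-- For large `R` the factor `C S R^(-2(s-a))` drops below `2^(-(N-2a))`; the common integral, being
finite, can then only be zero, and its weight is positive. -/
lemma ae_eq_zero_of_localized_le {a s C : ℝ} (ha : 0 ≤ a) (has : a < s) (hN : 2 * a ≤ N)
    (hC : 0 ≤ C) {w : EuclideanSpace ℝ (Fin N) → ENNReal} (hw : Measurable w)
    (hfin : ∫⁻ x, ENNReal.ofReal ((1 + ‖x‖) ^ (-(N : ℝ))) * w x < ⊤)
    (hloc : ∀ r, 1 ≤ r →
      ∫⁻ x in Metric.closedBall 0 r, ENNReal.ofReal ((1 + ‖x‖) ^ (-(2 * a))) * w x ≤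
      ENNReal.ofReal (C * r ^ (-(2 * s))) *
        ∫⁻ x, ENNReal.ofReal ((1 + ‖x‖ / r) ^ (-((N : ℝ) + 2 * s))) * w x) :
    ∀ᵐ x, w x = 0 := by
  obtain ⟨S, hS0, hS⟩ := exists_tsum_dyadic_eq (sub_pos.2 has)
  have hlim : Tendsto (fun R : ℝ => C * S * R ^ (-(2 * (s - a)))) atTop (𝓝 0) := by
    simpa using (tendsto_rpow_neg_atTop (y := 2 * (s - a)) (by linarith)).const_mul (C * S)
  have hpos : (0 : ℝ) < 2 ^ (-((N : ℝ) - 2 * a)) := by positivity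
  obtain ⟨R, hlt, hR⟩ := ((hlim.eventually_lt_const hpos).and (eventually_ge_atTop 1)).exists
  have hR0 : 0 < R := by linarith
  have hle := lintegral_dyadic_le ha has hN hC hS0 hS hw hloc hR
  set X := ∫⁻ x, ENNReal.ofReal
    ((1 + ‖x‖ / R) ^ (-((N : ℝ) - 2 * a)) * (1 + ‖x‖) ^ (-(2 * a))) * w x with hX
  have hXfin : X ≠ ⊤ := by
    refine ne_top_of_le_ne_top (ENNReal.mul_ne_top (ENNReal.ofReal_ne_top (r := R ^ ((N : ℝ) - 2 * a)))
      hfin.ne) ?_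
    rw [← lintegral_const_mul' _ _ ENNReal.ofReal_ne_top]
    refine lintegral_mono fun x => ?_
    rw [← mul_assoc, ← ENNReal.ofReal_mul (by positivity)]
    gcongr ENNReal.ofReal ?_ * _
    have h := one_add_norm_div_rpow_neg_le (q := N - 2 * a) (by linarith) hR x
    refine (mul_le_mul_of_nonneg_right h (by positivity)).trans (le_of_eq ?_)
    rw [mul_assoc, ← Real.rpow_add (by positivity)]
    ring_nf
  have hX0 : X = 0 := by
    by_contra hne
    exact absurd ((ENNReal.mul_le_mul_iff_left hne hXfin).1 hle)
      (not_le.2 ((ENNReal.ofReal_lt_ofReal_iff hpos).2 hlt))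
  have hmeas : Measurable fun x : EuclideanSpace ℝ (Fin N) => ENNReal.ofReal
      ((1 + ‖x‖ / R) ^ (-((N : ℝ) - 2 * a)) * (1 + ‖x‖) ^ (-(2 * a))) * w x :=
    (((((measurable_norm.div_const R).const_add 1).pow_const _).mul
      ((measurable_norm.const_add 1).pow_const _)).ennreal_ofReal).mul hw
  filter_upwards [(lintegral_eq_zero_iff hmeas).1 hX0] with x hx
  rcases mul_eq_zero.1 hx with h | h
  · exact absurd (ENNReal.ofReal_eq_zero.1 h) (not_le.2 (by positivity))
  · exact h

/-! ### Lower bound for the Riesz potential and tail integrability -/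

lemma exists_rieszPotential_ge {s : ℝ} (hs : 0 < s) (hN : 2 * s < N)
    {F : EuclideanSpace ℝ (Fin N) → ℝ} (hF : Continuous F) (hFc : HasCompactSupport F)
    (hF0 : ∀ x, 0 ≤ F x) (hFne : F ≠ 0) :
    ∃ κ, 0 < κ ∧ ∀ x, κ * (1 + ‖x‖) ^ (-((N : ℝ) - 2 * s)) ≤ rieszPotential s F x := by
  have hN1 : 1 ≤ N := by
    rcases Nat.eq_zero_or_pos N with rfl | h
    · simp at hN; linarith
    · exact h
  have : Nonempty (Fin N) := ⟨⟨0, hN1⟩⟩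
  set e : ℝ := N - 2 * s with he
  have he0 : 0 < e := by linarith
  set k : ℝ := Real.Gamma (((N : ℝ) - 2 * s) / 2) /
      ((4 : ℝ) ^ s * Real.pi ^ ((N : ℝ) / 2) * Real.Gamma s) with hk
  have hk0 : 0 < k := by
    have h1 : 0 < Real.Gamma (((N : ℝ) - 2 * s) / 2) := Real.Gamma_pos_of_pos (by linarith)
    have h2 := Real.Gamma_pos_of_pos hs
    have := Real.pi_pos
    positivity
  have hker : ∀ z : EuclideanSpace ℝ (Fin N), rieszKernel N s z = k * ‖z‖ ^ (-e) := by
    intro z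
    rw [rieszKernel, Real.rpow_neg (norm_nonneg z), div_eq_mul_inv]
  have hloc : LocallyIntegrable (fun z : EuclideanSpace ℝ (Fin N) => k * ‖z‖ ^ (-e)) := by
    refine locallyIntegrable_of_norm_le_rpow (C := k) (α := e) (by simpa using hN1)
      (by rw [finrank_euclideanSpace_fin]; linarith) ?_
      ((measurable_norm.pow_const _).const_mul _).aestronglyMeasurable
    filter_upwards with z
    rw [Real.norm_of_nonneg (by positivity)]
  have hint : ∀ x, Integrable (fun y => rieszKernel N s (x - y) * F y) := by
    intro x
    have h := hloc.integrable_smul_right_of_hasCompactSupport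
      (hF.comp (continuous_sub_left x)) (hFc.comp_homeomorph (Homeomorph.subLeft x))
    refine (h.comp_sub_left x).congr ?_
    filter_upwards with y
    simp [hker, mul_comm]
  obtain ⟨R, hR⟩ := hFc.isCompact.isBounded.subset_closedBall 0
  have hFint := hF.integrable_of_hasCompactSupport hFc (μ := volume)
  obtain ⟨x₀, hx₀⟩ := Function.ne_iff.1 hFne
  have hFpos : 0 < ∫ y, F y :=
    hF.integral_pos_of_hasCompactSupport_nonneg_nonzero hFc hF0 hx₀
  have hR0 : 0 ≤ R := by
    have := hR (subset_tsupport F hx₀)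
    exact dist_nonneg.trans (Metric.mem_closedBall.1 this)
  refine ⟨k * (1 + R) ^ (-e) * ∫ y, F y, by positivity, fun x => ?_⟩
  rw [mul_right_comm, ← integral_const_mul, rieszPotential]
  refine integral_mono_ae (hFint.const_mul _) (hint x) ?_
  -- The point `y = x` is discarded because there `‖x - y‖ ^ (-e)` takes the value `0` and the
  -- kernel bound fails.
  filter_upwards [Measure.ae_ne volume x] with y hy
  refine le_trans ?_ (le_of_eq (by rw [hker]))
  by_cases hyF : y ∈ tsupport F
  · refine mul_le_mul_of_nonneg_right ?_ (hF0 y)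
    rw [mul_assoc, ← Real.mul_rpow (by positivity) (by positivity)]
    refine mul_le_mul_of_nonneg_left ?_ hk0.le
    refine Real.rpow_le_rpow_of_nonpos (norm_pos_iff.2 (sub_ne_zero.2 hy.symm)) ?_ (by linarith)
    have h1 : ‖y‖ ≤ R := by simpa using hR hyF
    have h2 := norm_sub_le x y
    nlinarith [norm_nonneg x, mul_nonneg hR0 (norm_nonneg x)]
  · simp [image_eq_zero_of_notMem_tsupport hyF]

/-- Either `t ≤ A`, or `t^(1-p) ≤ A^(1-p)` as `1 - p ≤ 0`. This replaces Hölder's inequality and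
includes `p = 1`. -/
lemma le_add_rpow_mul {t A p : ℝ} (ht : 0 ≤ t) (hA : 0 < A) (hp : 1 ≤ p) :
    t ≤ A + t ^ p * A ^ (1 - p) := by
  rcases le_or_gt t A with h | h
  · exact le_add_of_le_of_nonneg h (by positivity)
  · refine le_add_of_nonneg_of_le hA.le ?_
    have h0 : 0 < t := hA.trans h
    calc t = t ^ p * t ^ (1 - p) := by rw [← Real.rpow_add h0]; simp
      _ ≤ t ^ p * A ^ (1 - p) := mul_le_mul_of_nonneg_left
          (Real.rpow_le_rpow_of_nonpos hA h.le (by linarith)) (by positivity)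

lemma TailIntegrable.mono {q q' : ℝ} (h : q ≤ q') {u : EuclideanSpace ℝ (Fin N) → ℝ}
    (hu : TailIntegrable q u) : TailIntegrable q' u := by
  have hm := hu.measurable
  refine ⟨hm, hu.integrable.mono' (Measurable.aestronglyMeasurable
    (((measurable_norm.const_add 1).pow_const _).mul hm.abs)) ?_⟩
  filter_upwards with x
  rw [Real.norm_of_nonneg (by positivity)]
  refine mul_le_mul_of_nonneg_right ?_ (abs_nonneg _)
  exact Real.rpow_le_rpow_of_exponent_le (by linarith [norm_nonneg x]) (by linarith)

/-- Weighted `L^p` integrability with a slightly heavier weight gives the `L^1` tail condition. -/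
lemma MemWeightedLp.tailIntegrable {p δ κ : ℝ} (hp : 1 ≤ p) (hδ : 0 < δ) (hκ : 0 < κ)
    {W u : EuclideanSpace ℝ (Fin N) → ℝ} (hW : ∀ x, κ * (1 + ‖x‖) ^ (-(N : ℝ) + δ) ≤ W x)
    (hu : MemWeightedLp p W u) : TailIntegrable N u := by
  obtain ⟨hm, hfin⟩ := hu
  have hp0 : 0 < p := by linarith
  -- With threshold `A = (1 + |x|)^(-θ)`, positivity of `θ` makes the first term integrable, and
  -- `θ(p-1) ≤ δ` lets the weight control the second.
  set θ : ℝ := δ / p with hθ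
  have hθ0 : 0 < θ := by positivity
  have hθp : θ * (p - 1) ≤ δ := by
    have : θ * p = δ := by rw [hθ]; field_simp
    nlinarith
  have hJ : Integrable fun x : EuclideanSpace ℝ (Fin N) => (1 + ‖x‖) ^ (-(N + θ)) :=
    integrable_one_add_norm (by simpa using hθ0)
  refine ⟨hm, ⟨Measurable.aestronglyMeasurable
    (((measurable_norm.const_add 1).pow_const _).mul hm.abs), ?_⟩⟩
  rw [hasFiniteIntegral_iff_ofReal (by filter_upwards with x; positivity)]
  have hpt : ∀ x, (1 + ‖x‖) ^ (-(N : ℝ)) * |u x| ≤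
      (1 + ‖x‖) ^ (-(N + θ)) + κ⁻¹ * (|u x| ^ p * W x) := by
    intro x
    have h1 : 0 < 1 + ‖x‖ := by positivity
    have h2 := le_add_rpow_mul (abs_nonneg (u x)) (by positivity : 0 < (1 + ‖x‖) ^ (-θ)) hp
    rw [← Real.rpow_mul h1.le] at h2
    calc (1 + ‖x‖) ^ (-(N : ℝ)) * |u x|
        ≤ (1 + ‖x‖) ^ (-(N : ℝ)) *
          ((1 + ‖x‖) ^ (-θ) + |u x| ^ p * (1 + ‖x‖) ^ (-θ * (1 - p))) := by gcongr
      _ = (1 + ‖x‖) ^ (-(N + θ)) + |u x| ^ p * (1 + ‖x‖) ^ (-(N : ℝ) + θ * (p - 1)) := by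
          rw [neg_add, Real.rpow_add h1, Real.rpow_add h1,
            show -θ * (1 - p) = θ * (p - 1) by ring]
          ring
      _ ≤ _ := by
          refine add_le_add_right ?_ _
          rw [mul_left_comm]
          refine mul_le_mul_of_nonneg_left ?_ (by positivity)
          rw [← div_eq_inv_mul, le_div_iff₀ hκ, mul_comm]
          refine le_trans (mul_le_mul_of_nonneg_left ?_ hκ.le) (hW x)
          exact Real.rpow_le_rpow_of_exponent_le (by linarith [norm_nonneg x]) (by linarith)
  calc ∫⁻ x, ENNReal.ofReal ((1 + ‖x‖) ^ (-(N : ℝ)) * |u x|)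
      ≤ ∫⁻ x, (ENNReal.ofReal ((1 + ‖x‖) ^ (-(N + θ))) +
          ENNReal.ofReal κ⁻¹ * ENNReal.ofReal (|u x| ^ p * W x)) := by
        refine lintegral_mono fun x => (ENNReal.ofReal_le_ofReal (hpt x)).trans ?_
        refine ENNReal.ofReal_add_le.trans ?_
        rw [ENNReal.ofReal_mul (by positivity)]
    _ = (∫⁻ x : EuclideanSpace ℝ (Fin N), ENNReal.ofReal ((1 + ‖x‖) ^ (-(N + θ)))) +
          ENNReal.ofReal κ⁻¹ * ∫⁻ x, ENNReal.ofReal (|u x| ^ p * W x) := by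
        rw [lintegral_add_left ((measurable_norm.const_add 1).pow_const _).ennreal_ofReal,
          lintegral_const_mul' _ _ ENNReal.ofReal_ne_top]
    _ < ⊤ := ENNReal.add_lt_top.2 ⟨hJ.lintegral_lt_top, ENNReal.mul_lt_top ENNReal.ofReal_lt_top hfin⟩

lemma one_add_norm_rpow_le {α a : ℝ} (h : α ≤ a) (ha : 0 ≤ a) (x : EuclideanSpace ℝ (Fin N)) :
    (1 + ‖x‖) ^ (-(2 * a)) ≤ (1 + ‖x‖ ^ 2) ^ (-α) := by
  have h1 : (1 + ‖x‖) ^ (-(2 * a)) ≤ (1 + ‖x‖ ^ 2) ^ (-a) := by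
    rw [← mul_neg, Real.rpow_mul (by positivity)]
    refine Real.rpow_le_rpow_of_nonpos (by positivity) ?_ (by linarith)
    rw [Real.rpow_two]
    nlinarith [norm_nonneg x]
  exact h1.trans (Real.rpow_le_rpow_of_exponent_le (by nlinarith [norm_nonneg x]) (by linarith))

end FracElliptic

/-! ### Conclusion -/

theorem theorem2p11 (N : ℕ) (s : ℝ) (hs0 : 0 < s) (hs1 : s < 1) (hN : 2 * s < (N : ℝ))
    (ρ c : EuclideanSpace ℝ (Fin N) → ℝ)
    (hρ : Continuous ρ) (hρpos : ∀ x, 0 < ρ x)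
    (K α : ℝ) (hK : 0 < K) (hα : α < s)
    (hρlow : ∀ x, K * (1 + ‖x‖ ^ 2) ^ (-α) ≤ ρ x)
    (hc : Continuous c) (hcnonneg : ∀ x, 0 ≤ c x)
    (c₀ : ℝ) (hc₀ : 0 < c₀) (hclow : ∀ x, c₀ ≤ c x)
    (F : EuclideanSpace ℝ (Fin N) → ℝ) (hF : ContDiff ℝ ∞ F) (hFsupp : HasCompactSupport F)
    (hFnonneg : ∀ x, 0 ≤ F x) (hFne : F ≠ 0)
    (p : ℝ) (hp : 1 ≤ p)
    (u : EuclideanSpace ℝ (Fin N) → ℝ) (hu : FracElliptic.IsSolution s ρ c u)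
    (hup : FracElliptic.MemWeightedLp p
      (fun x => c x * ρ x * FracElliptic.rieszPotential s F x) u) :
    ∀ x, u x = 0 := by
  open FracElliptic in
  have hN1 : 1 ≤ N := by
    rcases Nat.eq_zero_or_pos N with rfl | h
    · simp at hN; linarith
    · exact h
  -- A negative `α` is replaced by `0`: the absorption needs `0 ≤ a < s`.
  set a : ℝ := max α 0 with ha_def
  have ha0 : 0 ≤ a := le_max_right _ _
  have has : a < s := max_lt hα hs0
  have hV : ∀ x, K * c₀ * (1 + ‖x‖) ^ (-(2 * a)) ≤ ρ x * c x := by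
    intro x
    have h1 := mul_le_mul_of_nonneg_left (one_add_norm_rpow_le (le_max_left α 0) ha0 x) hK.le
    calc K * c₀ * (1 + ‖x‖) ^ (-(2 * a)) = K * (1 + ‖x‖) ^ (-(2 * a)) * c₀ := by ring
      _ ≤ ρ x * c x := mul_le_mul (h1.trans (hρlow x)) (hclow x) hc₀.le (hρpos x).le
  obtain ⟨κ, hκ, hφ⟩ := exists_rieszPotential_ge hs0 hN hF.continuous hFsupp hFnonneg hFne
  -- The exponents `-2a` of `ρ c` and `-(N-2s)` of the potential add to `-N + 2(s-a)`.
  have htail : TailIntegrable N u := by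
    refine MemWeightedLp.tailIntegrable (δ := 2 * (s - a)) (κ := K * c₀ * κ) hp (by linarith)
      (by positivity) (fun x => ?_) hup
    have h1 : 0 < 1 + ‖x‖ := by positivity
    calc K * c₀ * κ * (1 + ‖x‖) ^ (-(N : ℝ) + 2 * (s - a))
        = K * c₀ * (1 + ‖x‖) ^ (-(2 * a)) * (κ * (1 + ‖x‖) ^ (-((N : ℝ) - 2 * s))) := by
          rw [show -(N : ℝ) + 2 * (s - a) = -(2 * a) + -((N : ℝ) - 2 * s) by ring,
            Real.rpow_add h1]
          ring
      _ ≤ ρ x * c x * rieszPotential s F x := mul_le_mul (hV x) (hφ x) (by positivity)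
          (mul_nonneg (hρpos x).le (hcnonneg x))
      _ = _ := by ring
  have htail' : TailIntegrable (N + 2 * s) u := htail.mono (by linarith)
  obtain ⟨C, hC, hloc⟩ := hu.exists_setIntegral_closedBall_le hs0 hs1 hN1 hρ hc
    (fun x => (hρpos x).le) hcnonneg htail'
  have hcont := hu.regular.continuous hs0
  have hae : ∀ᵐ x, ENNReal.ofReal |u x| = 0 := by
    refine ae_eq_zero_of_localized_le (C := (K * c₀)⁻¹ * C) ha0 has (by linarith) (by positivity)
      htail.measurable.abs.ennreal_ofReal ?_ fun r hr => ?_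
    · simp_rw [← ENNReal.ofReal_mul (Real.rpow_nonneg (add_nonneg zero_le_one (norm_nonneg _)) _)]
      exact htail.integrable.lintegral_lt_top
    · have hr0 : 0 < r := by linarith
      have hint : IntegrableOn (fun x => (K * c₀)⁻¹ * (ρ x * c x * |u x|))
          (Metric.closedBall 0 r) :=
        ((continuous_const.mul ((hρ.mul hc).mul hcont.abs)).continuousOn).integrableOn_compact
          (isCompact_closedBall _ _)
      have hsc := htail'.integrable_scaled (by positivity) hr
      calc ∫⁻ x in Metric.closedBall 0 r,
            ENNReal.ofReal ((1 + ‖x‖) ^ (-(2 * a))) * ENNReal.ofReal |u x|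
          ≤ ∫⁻ x in Metric.closedBall 0 r,
            ENNReal.ofReal ((K * c₀)⁻¹ * (ρ x * c x * |u x|)) := by
            refine lintegral_mono fun x => ?_
            rw [← ENNReal.ofReal_mul (by positivity)]
            refine ENNReal.ofReal_le_ofReal ?_
            rw [← mul_assoc]
            refine mul_le_mul_of_nonneg_right ?_ (abs_nonneg _)
            rw [← div_eq_inv_mul, le_div_iff₀ (by positivity), mul_comm]
            exact hV x
        _ = ENNReal.ofReal (∫ x in Metric.closedBall 0 r, (K * c₀)⁻¹ * (ρ x * c x * |u x|)) := by
            refine (ofReal_integral_eq_lintegral_ofReal hint ?_).symm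
            filter_upwards with x
            exact mul_nonneg (by positivity)
              (mul_nonneg (mul_nonneg (hρpos x).le (hcnonneg x)) (abs_nonneg _))
        _ ≤ ENNReal.ofReal ((K * c₀)⁻¹ * C * r ^ (-(2 * s)) *
              ∫ x, (1 + ‖x‖ / r) ^ (-((N : ℝ) + 2 * s)) * |u x|) := by
            refine ENNReal.ofReal_le_ofReal ?_
            rw [integral_const_mul, mul_assoc (K * c₀)⁻¹, mul_assoc (K * c₀)⁻¹]
            exact mul_le_mul_of_nonneg_left (hloc r hr) (by positivity)
        _ = _ := by
            rw [ENNReal.ofReal_mul (by positivity), ofReal_integral_eq_lintegral_ofReal hsc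
              (by filter_upwards with x; positivity)]
            congr 1
            refine lintegral_congr fun x => ?_
            rw [ENNReal.ofReal_mul (by positivity)]
  have hzero : u =ᵐ[volume] fun _ => 0 := by
    filter_upwards [hae] with x hx
    simpa using hx
  exact fun x => congrFun ((hcont.ae_eq_iff_eq volume continuous_const).1 hzero) x
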